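/- Let $\alpha>0$, let $X_1,X_2,\dots$ be i.i.d. $\alpha$-Pareto random variables, $\mathbb P(X_i>x)=x^{-\alpha}$ for $x\ge 1$, and let $X_{(1)}\le\dots\le X_{(n)}$ be the order statistics of $X_1,\dots,X_n$. Fix an integer $k\ge 1$ and, for $n\ge k$, let $T_k=\sum_{j=1}^{n-k}X_{(j)}$ be the sum of the $n-k$ smallest ones. For $y>1$, let $\mathcal L(T_k\mid X_{(n-k+1)}=y)$ denote the weak limit, as $\varepsilon\downarrow 0$, of the law of $T_k$ conditioned on the event $|X_{(n-k+1)}-y|\le\varepsilon$. Then the following hold. (1) For every $n\ge k$ and every $y>1$, the law $\mathcal L(T_k\mid X_{(n-k+1)}=y)$ exists and is the law of $Y_1+\dots+Y_{n-k}$, where the $Y_j$ are i.i.d. with the $\alpha$-Pareto law conditioned on $[1,y]$. For almost every $y$ with respect to the law of $X_{(n-k+1)}$, it coincides with the regular conditional distribution of $T_k$ given $X_{(n-k+1)}$. (2) For every $n\ge k$ and $y>1$, this law has a finite second moment, and its mean and variance are $$m_1(\alpha,n,k,y)=\frac{n-k}{1-y^{-\alpha}}\times\begin{cases}\dfrac{1-y^{1-\alpha}}{1-1/\alpha}&\text{if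 }\alpha\ne1,\\[2mm] \ln y&\text{if }\alpha=1,\end{cases}$$ $$\sigma^2(\alpha,n,k,y)=\begin{cases}(n-k)\,y\left(1-\dfrac{y\ln^2 y}{(y-1)^2}\right)&\text{if }\alpha=1,\\[3mm] 2(n-k)\dfrac{y^2}{y^2-1}\left(\ln y-2\,\dfrac{y-1}{y+1}\right)&\text{if }\alpha=2,\\[3mm] \dfrac{n-k}{1-y^{-\alpha}}\left(\dfrac{1-y^{2-\alpha}}{1-2/\alpha}-\dfrac{1}{(1-1/\alpha)^2}\,\dfrac{(1-y^{1-\alpha})^2}{1-y^{-\alpha}}\right)&\text{if }\alpha\ne1,2,\end{cases}$$ and $\sigma^2(\alpha,n,k,y)>0$ when $n>k$. (3) For every $y>1$, as $n\to\infty$ with $k$ and $y$ fixed, $\mathcal L(T_k\mid X_{(n-k+1)}=y)$ is asymptotically $\mathcal N\big(m_1(\alpha,n,k,y),\sigma^2(\alpha,n,k,y)\big)$: under this conditional law, $(T_k-m_1)/\sigma$ converges in distribution to $\mathcal N(0,1)$, and the supremum over $x\in\mathbb R$ of the absolute difference between the distribution functions of $\mathcal L(T_k\mid X_{(n-k+1)}=y)$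 and of $\mathcal N(m_1,\sigma^2)$ tends to $0$. -/

import Mathlib

open MeasureTheory ProbabilityTheory Filter Topology Set
open scoped BoundedContinuousFunction

noncomputable section

/-- The `j`-th smallest (`1 ≤ j ≤ n`) among the first `n` variables `X 0 ω, …, X (n-1) ω` of a
sequence; the value outside the range `1 ≤ j ≤ n` is irrelevant. -/
def orderStat {Ω : Type*} (X : ℕ → Ω → ℝ) (n j : ℕ) (ω : Ω) : ℝ :=
  if h : 1 ≤ j ∧ j ≤ n then
    (fun i : Fin n => X i ω) (Tuple.sort (fun i : Fin n => X i ω) ⟨j - 1, by omega⟩)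
  else 0

/-- The trimmed sum `T_k`: the sum of the `n - k` smallest order statistics. -/
def trimmedSum {Ω : Type*} (X : ℕ → Ω → ℝ) (n k : ℕ) (ω : Ω) : ℝ :=
  ∑ j ∈ Finset.Icc 1 (n - k), orderStat X n j ω

/-- The `α`-Pareto law on `[1, ∞)` (with cdf `1 - x ^ (-α)`) conditioned on `[1, y]`. -/
def truncPareto (α y : ℝ) : Measure ℝ :=
  ProbabilityTheory.cond (paretoMeasure 1 α) (Icc 1 y)

/-- The law of `Y_1 + ⋯ + Y_m` for `Y_1, …, Y_m` independent with law `truncPareto α y`. -/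
def truncParetoSumLaw (α y : ℝ) (m : ℕ) : Measure ℝ :=
  (Measure.pi (fun _ : Fin m => truncPareto α y)).map (fun v => ∑ i, v i)

/-- `ν` is the conditional law of `T` given `Z = y` at the point `y` of the support of `Z`: the
elementary conditional laws of `T` given `|Z - y| ≤ ε` converge weakly to `ν` as `ε ↓ 0`. -/
def IsCondLawAt {Ω : Type*} [MeasurableSpace Ω] (P : Measure Ω) (T Z : Ω → ℝ) (y : ℝ)
    (ν : Measure ℝ) : Prop :=
  IsProbabilityMeasure ν ∧
  (∀ ε : ℝ, 0 < ε → P (Z ⁻¹' Icc (y - ε) (y + ε)) ≠ 0) ∧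
  ∀ f : ℝ →ᵇ ℝ,
    Tendsto (fun ε : ℝ => ∫ ω, f (T ω) ∂(ProbabilityTheory.cond P (Z ⁻¹' Icc (y - ε) (y + ε))))
      (𝓝[>] 0) (𝓝 (∫ t, f t ∂ν))

open Classical in
/-- The mean `m_1(α, n, k, y)`. -/
def trimmedMean (α : ℝ) (n k : ℕ) (y : ℝ) : ℝ :=
  ((n : ℝ) - k) / (1 - y ^ (-α)) *
    (if α = 1 then Real.log y else (1 - y ^ (1 - α)) / (1 - 1 / α))

open Classical in
/-- The variance `σ²(α, n, k, y)`. -/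
def trimmedVar (α : ℝ) (n k : ℕ) (y : ℝ) : ℝ :=
  if α = 1 then
    ((n : ℝ) - k) * y * (1 - y * Real.log y ^ 2 / (y - 1) ^ 2)
  else if α = 2 then
    2 * ((n : ℝ) - k) * (y ^ 2 / (y ^ 2 - 1)) * (Real.log y - 2 * ((y - 1) / (y + 1)))
  else
    ((n : ℝ) - k) / (1 - y ^ (-α)) *
      ((1 - y ^ (2 - α)) / (1 - 2 / α)
        - 1 / (1 - 1 / α) ^ 2 * ((1 - y ^ (1 - α)) ^ 2 / (1 - y ^ (-α))))

end

/-! Write `n = m + 1 + l` and `k = l + 1`, and let `μ` be the Pareto law. It has no atoms, so the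
sample almost surely has distinct entries, and by symmetry integrals of permutation-invariant
functions reduce, up to a combinatorial factor, to the samples whose coordinate `p = m` exceeds all
earlier coordinates and is below all later ones (`splitCount_mul_lintegral`). On this set the order
statistic `Z` is coordinate `p` and `T_k` is the sum of the first `m` coordinates.

Fubini with coordinate `p` fixed at `z` gives the law of `Z` the density `μ[1,z]^m μ(z,∞)^l`, up to
a constant, and makes the first `m` coordinates i.i.d. with law `μ` conditioned on `[1,z]`
(`lintegral_orderStat`). This is a disintegration of the law of `(Z, T_k)`, hence the regular
conditional distribution. Its kernel is weakly continuous at every `y > 1` and `Z` charges each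
neighbourhood of `y`, so conditioning on `|Z - y| ≤ ε` converges to the kernel at `y`
(`tendsto_integral_cond_of_compProd`).

What remains concerns sums of bounded i.i.d. variables: explicit moments, the central limit theorem,
and Pólya's theorem for uniformity. -/

/-! ### Order statistics of vectors and reduction to split vectors. -/

/-- The `j`-th order statistic of a vector. -/
noncomputable def vecOrderStat {n : ℕ} (v : Fin n → ℝ) (j : Fin n) : ℝ := v (Tuple.sort v j)

lemma vecOrderStat_comp_perm {n : ℕ} (v : Fin n → ℝ) (σ : Equiv.Perm (Fin n)) (j : Fin n) :
    vecOrderStat (v ∘ σ) j = vecOrderStat v j :=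
  congrFun (Tuple.comp_perm_comp_sort_eq_comp_sort (f := v) (σ := σ)) j

lemma card_filter_comp_perm {n : ℕ} (p : Fin n → Prop) [DecidablePred p]
    (σ : Equiv.Perm (Fin n)) :
    (Finset.univ.filter fun i => p (σ i)).card = (Finset.univ.filter p).card := by
  refine Finset.card_equiv σ fun i => ?_
  simp

/-- Counting entries ignores their order, so the count may be made along the sorted vector. This
form gives measurability. -/
lemma vecOrderStat_le_iff {n : ℕ} (v : Fin n → ℝ) (j : Fin n) (a : ℝ) :
    vecOrderStat v j ≤ a ↔ (j : ℕ) < (Finset.univ.filter fun i => v i ≤ a).card := by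
  have h := Tuple.lt_card_le_iff_apply_le_of_monotone (j := j) (a := a) (Tuple.monotone_sort v)
  rw [← card_filter_comp_perm (fun i => v i ≤ a) (Tuple.sort v)]
  exact h.symm

lemma vecOrderStat_lt_iff {n : ℕ} (v : Fin n → ℝ) (j : Fin n) (a : ℝ) :
    vecOrderStat v j < a ↔ (j : ℕ) < (Finset.univ.filter fun i => v i < a).card := by
  have h := Tuple.lt_card_lt_iff_apply_lt_of_monotone (j := j) (a := a) (Tuple.monotone_sort v)
  rw [← card_filter_comp_perm (fun i => v i < a) (Tuple.sort v)]
  exact h.symm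

lemma measurable_vecOrderStat {n : ℕ} (j : Fin n) :
    Measurable fun v : Fin n → ℝ => vecOrderStat v j := by
  refine measurable_of_Iic fun a => ?_
  have hm : Measurable fun v : Fin n → ℝ => ∑ i, if v i ≤ a then (1 : ℕ) else 0 := by
    refine Finset.measurable_fun_sum _ fun i _ => ?_
    exact Measurable.ite (measurableSet_le (measurable_pi_apply i) measurable_const)
      measurable_const measurable_const
  have : (fun v : Fin n → ℝ => vecOrderStat v j) ⁻¹' Iic a
      = {v | (j : ℕ) < ∑ i, if v i ≤ a then (1 : ℕ) else 0} := by
    ext v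
    simp [vecOrderStat_le_iff]
  rw [this]
  exact measurableSet_lt measurable_const hm

/-- The vectors whose entry at `p` is larger than the entries before it and smaller than those
after it. -/
def splitAt {n : ℕ} (p : Fin n) : Set (Fin n → ℝ) :=
  {v | (∀ j < p, v j < v p) ∧ ∀ j, p < j → v p < v j}

lemma measurableSet_splitAt {n : ℕ} (p : Fin n) : MeasurableSet (splitAt p) := by
  unfold splitAt
  measurability

section

variable {n : ℕ} {p : Fin n} {v : Fin n → ℝ}

lemma lt_iff_of_mem_splitAt (hv : v ∈ splitAt p) (i : Fin n) : v i < v p ↔ i < p := by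
  refine ⟨fun h => ?_, hv.1 i⟩
  by_contra hi
  rcases (not_lt.1 hi).eq_or_lt with rfl | hi
  · exact lt_irrefl _ h
  · exact lt_asymm h (hv.2 i hi)

lemma le_iff_of_mem_splitAt (hv : v ∈ splitAt p) (i : Fin n) : v i ≤ v p ↔ i ≤ p := by
  refine ⟨fun h => ?_, fun h => ?_⟩
  · by_contra hi
    exact (hv.2 i (not_le.1 hi)).not_ge h
  · rcases h.eq_or_lt with rfl | hi
    · exact le_rfl
    · exact (hv.1 i hi).le

lemma vecOrderStat_of_mem_splitAt (hv : v ∈ splitAt p) : vecOrderStat v p = v p := by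
  refine le_antisymm ?_ (not_lt.1 fun h => ?_)
  · rw [vecOrderStat_le_iff]
    simp only [le_iff_of_mem_splitAt hv]
    have : (Finset.univ.filter fun i => i ≤ p) = Finset.Iic p := by ext; simp
    rw [this, Fin.card_Iic]
    exact Nat.lt_succ_self _
  · rw [vecOrderStat_lt_iff] at h
    simp only [lt_iff_of_mem_splitAt hv] at h
    have : (Finset.univ.filter fun i => i < p) = Finset.Iio p := by ext; simp
    rw [this, Fin.card_Iio] at h
    exact lt_irrefl _ h

lemma sort_apply_of_mem_splitAt (hv : v ∈ splitAt p) : Tuple.sort v p = p := by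
  have h : v (Tuple.sort v p) = v p := vecOrderStat_of_mem_splitAt hv
  rcases lt_trichotomy (Tuple.sort v p) p with h' | h' | h'
  · exact absurd h (hv.1 _ h').ne
  · exact h'
  · exact absurd h (hv.2 _ h').ne'

/-- Ties inside a block are allowed, so `sort` is only known to fix `p` and to preserve the two
blocks. That suffices to reindex the sum over the first block. -/
lemma sort_lt_iff_of_mem_splitAt (hv : v ∈ splitAt p) (j : Fin n) :
    Tuple.sort v j < p ↔ j < p := by
  have hp := sort_apply_of_mem_splitAt hv
  have hmono := Tuple.monotone_sort v
  have hne : j ≠ p → Tuple.sort v j ≠ p := fun hj h =>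
    hj ((Tuple.sort v).injective (h.trans hp.symm))
  constructor
  · intro h
    by_contra hj
    have h1 := hmono (not_lt.1 hj)
    simp only [Function.comp_apply, hp] at h1
    exact (hv.1 _ h).not_ge h1
  · intro h
    have h1 := hmono h.le
    simp only [Function.comp_apply, hp] at h1
    exact lt_of_le_of_ne ((le_iff_of_mem_splitAt hv _).1 h1) (hne h.ne)

lemma sum_vecOrderStat_of_mem_splitAt (hv : v ∈ splitAt p) :
    ∑ j ∈ Finset.Iio p, vecOrderStat v j = ∑ j ∈ Finset.Iio p, v j := by
  refine Finset.sum_equiv (Tuple.sort v) (fun i => ?_) fun i _ => rfl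
  simp [sort_lt_iff_of_mem_splitAt hv]

lemma comp_mem_splitAt_iff (hv : StrictMono v) (ρ : Equiv.Perm (Fin n)) :
    v ∘ ρ ∈ splitAt p ↔ (∀ j < p, ρ j < ρ p) ∧ ∀ j, p < j → ρ p < ρ j := by
  simp [splitAt, hv.lt_iff_lt]

/-- The number of permutations preserving the blocks before and after `p`. -/
noncomputable def splitCount (p : Fin n) : ℕ :=
  Nat.card {ρ : Equiv.Perm (Fin n) // (∀ j < p, ρ j < ρ p) ∧ ∀ j, p < j → ρ p < ρ j}

/-- The count is a product of two factorials, but only its non-vanishing matters: normalising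
constants are never computed. -/
lemma splitCount_ne_zero (p : Fin n) : splitCount p ≠ 0 := by
  have : Nonempty {ρ : Equiv.Perm (Fin n) // (∀ j < p, ρ j < ρ p) ∧ ∀ j, p < j → ρ p < ρ j} :=
    ⟨1, fun _ h => h, fun _ h => h⟩
  exact Nat.card_pos.ne'

lemma sum_indicator_splitAt (hv : Function.Injective v) :
    ∑ σ : Equiv.Perm (Fin n), (splitAt p).indicator (1 : (Fin n → ℝ) → ENNReal) (v ∘ σ)
      = splitCount p := by
  classical
  have hs : StrictMono (v ∘ Tuple.sort v) :=
    (Tuple.monotone_sort v).strictMono_of_injective (hv.comp (Tuple.sort v).injective)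
  -- Substituting `σ = sort v * ρ` replaces `v` by a strictly increasing vector, for which
  -- membership depends on `ρ` alone.
  rw [← Equiv.sum_comp (Equiv.mulLeft (Tuple.sort v))]
  have (ρ : Equiv.Perm (Fin n)) : v ∘ (Equiv.mulLeft (Tuple.sort v) ρ) = (v ∘ Tuple.sort v) ∘ ρ := by
    ext; simp
  simp only [this, indicator_apply, comp_mem_splitAt_iff hs, Pi.one_apply, Finset.sum_boole,
    splitCount, Nat.card_eq_fintype_card, Fintype.card_subtype]

/-- Integrals of permutation-invariant functions reduce to the vectors split at `p`. -/
lemma splitCount_mul_lintegral {μ : Measure ℝ} [IsProbabilityMeasure μ] [NullSingletonClass μ]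
    {G : (Fin n → ℝ) → ENNReal} (hG : Measurable G)
    (hsymm : ∀ v (σ : Equiv.Perm (Fin n)), G (v ∘ σ) = G v) (p : Fin n) :
    splitCount p * ∫⁻ v, G v ∂(Measure.pi fun _ : Fin n => μ)
      = n.factorial * ∫⁻ v in splitAt p, G v ∂(Measure.pi fun _ : Fin n => μ) := by
  set π := Measure.pi fun _ : Fin n => μ
  -- Two coordinates have joint law `μ.prod μ`, for which the diagonal is null since `μ` has no
  -- atoms.
  have hinj : ∀ᵐ v ∂π, Function.Injective v := by
    have h1 : ∀ i j : Fin n, i ≠ j → ∀ᵐ v ∂π, v i ≠ v j := by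
      intro i j hij
      have hind : IndepFun (fun v : Fin n → ℝ => v i) (fun v => v j) π :=
        (iIndepFun_pi (μ := fun _ : Fin n => μ) (X := fun _ x => x)
          fun i => aemeasurable_id).indepFun hij
      have hmap : π.map (fun v => (v i, v j)) = μ.prod μ := by
        rw [(indepFun_iff_map_prod_eq_prod_map_map (measurable_pi_apply i).aemeasurable
          (measurable_pi_apply j).aemeasurable).1 hind]
        have (i : Fin n) : π.map (fun v => v i) = μ := by
          simpa using (measurePreserving_eval (fun _ : Fin n => μ) i).map_eq
        rw [this, this]
      have hd : (μ.prod μ) {q | q.1 = q.2} = 0 := by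
        rw [Measure.measure_prod_null (measurableSet_eq_fun measurable_fst measurable_snd)]
        refine ae_of_all _ fun x => ?_
        have : Prod.mk x ⁻¹' {q : ℝ × ℝ | q.1 = q.2} = {x} := by ext y; simp [eq_comm]
        simp [this]
      rw [← hmap, Measure.map_apply (by fun_prop)
        (measurableSet_eq_fun measurable_fst measurable_snd)] at hd
      rw [ae_iff]
      simpa using hd
    have h2 : ∀ᵐ v ∂π, ∀ i j : Fin n, i ≠ j → v i ≠ v j := by
      simp only [ae_all_iff]
      exact h1
    filter_upwards [h2] with v hv i j hij
    by_contra h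
    exact hv i j h hij
  have hmp (σ : Equiv.Perm (Fin n)) : MeasurePreserving (fun v : Fin n → ℝ => v ∘ σ) π π := by
    refine ⟨by fun_prop, ?_⟩
    refine (Measure.pi_eq fun s hs => ?_).symm
    rw [Measure.map_apply (by fun_prop) (MeasurableSet.univ_pi hs)]
    have : (fun v : Fin n → ℝ => v ∘ σ) ⁻¹' univ.pi s = univ.pi fun i => s (σ.symm i) := by
      ext v
      simp only [mem_preimage, mem_univ_pi, Function.comp_apply]
      exact ⟨fun h i => by simpa using h (σ.symm i), fun h i => by simpa using h (σ i)⟩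
    rw [this, Measure.pi_pi]
    exact Equiv.prod_comp σ.symm fun i => μ (s i)
  have hA := measurableSet_splitAt p
  calc splitCount p * ∫⁻ v, G v ∂π
      = ∫⁻ v, splitCount p * G v ∂π := (lintegral_const_mul _ hG).symm
    _ = ∫⁻ v, ∑ σ : Equiv.Perm (Fin n), (splitAt p).indicator G (v ∘ σ) ∂π := by
        refine lintegral_congr_ae ?_
        filter_upwards [hinj] with v hv
        rw [← sum_indicator_splitAt hv, Finset.sum_mul]
        refine Finset.sum_congr rfl fun σ _ => ?_
        by_cases h : v ∘ σ ∈ splitAt p <;> simp [h, hsymm]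
    _ = ∑ σ : Equiv.Perm (Fin n), ∫⁻ v, (splitAt p).indicator G (v ∘ σ) ∂π := by
        refine lintegral_finsetSum _ fun σ _ => ?_
        exact (hG.indicator hA).comp (hmp σ).measurable
    _ = ∑ σ : Equiv.Perm (Fin n), ∫⁻ v in splitAt p, G v ∂π := by
        refine Finset.sum_congr rfl fun σ _ => ?_
        rw [(hmp σ).lintegral_comp (hG.indicator hA), lintegral_indicator hA]
    _ = n.factorial * ∫⁻ v in splitAt p, G v ∂π := by
        simp [Finset.card_univ, Fintype.card_perm]

end

/-! ### The Pareto law and its truncations. -/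

lemma pareto_Iio_one (α : ℝ) : paretoMeasure 1 α (Iio 1) = 0 := by
  rw [paretoMeasure, withDensity_apply _ measurableSet_Iio, lintegral_paretoPDF_of_le le_rfl]

instance (α : ℝ) : NullSingletonClass (paretoMeasure 1 α) := by
  unfold paretoMeasure; infer_instance

lemma pareto_Ioo_pos {α a b : ℝ} (hα : 0 < α) (ha : 1 ≤ a) (hab : a < b) :
    0 < paretoMeasure 1 α (Ioo a b) := by
  have hm : Measurable (paretoPDF 1 α) := (measurable_paretoPDFReal 1 α).ennreal_ofReal
  rw [paretoMeasure, withDensity_apply _ measurableSet_Ioo, setLIntegral_pos_iff hm]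
  have : Ioo a b ⊆ Function.support (paretoPDF 1 α) ∩ Ioo a b := by
    refine fun x hx => ⟨?_, hx⟩
    exact (ENNReal.ofReal_pos.2 (paretoPDFReal_pos one_pos hα (ha.trans hx.1.le))).ne'
  refine lt_of_lt_of_le ?_ (measure_mono this)
  simp [hab]

lemma pareto_Icc_pos {α y : ℝ} (hα : 0 < α) (hy : 1 < y) : 0 < paretoMeasure 1 α (Icc 1 y) :=
  (pareto_Ioo_pos hα le_rfl hy).trans_le (measure_mono Ioo_subset_Icc_self)

lemma pareto_Ioi_pos {α : ℝ} (hα : 0 < α) (y : ℝ) : 0 < paretoMeasure 1 α (Ioi y) :=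
  (pareto_Ioo_pos hα (le_max_left 1 y) (lt_add_one (max 1 y))).trans_le
    (measure_mono fun _ hx => (le_max_right 1 y).trans_lt hx.1)

lemma pareto_Iio_ae_eq_Icc (α z : ℝ) : Iio z =ᵐ[paretoMeasure 1 α] Icc 1 z := by
  refine Iio_ae_eq_Iic.trans ?_
  have h : ∀ᵐ x ∂paretoMeasure 1 α, 1 ≤ x := by
    rw [ae_iff]
    simp only [not_le]
    exact pareto_Iio_one α
  filter_upwards [h] with x hx
  exact propext ⟨fun h => ⟨hx, h⟩, fun h => h.2⟩

lemma isProbabilityMeasure_truncPareto {α y : ℝ} (hα : 0 < α) (hy : 1 < y) :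
    IsProbabilityMeasure (truncPareto α y) := by
  have := isProbabilityMeasure_paretoMeasure one_pos hα
  exact cond_isProbabilityMeasure (pareto_Icc_pos hα hy).ne'

lemma measurable_sum_pi (m : ℕ) : Measurable fun v : Fin m → ℝ => ∑ i, v i := by fun_prop

lemma isProbabilityMeasure_truncParetoSumLaw {α y : ℝ} (hα : 0 < α) (hy : 1 < y) (m : ℕ) :
    IsProbabilityMeasure (truncParetoSumLaw α y m) := by
  have := isProbabilityMeasure_truncPareto hα hy
  exact Measure.isProbabilityMeasure_map (measurable_sum_pi m).aemeasurable

/-- The dependence on `y` is isolated in a scalar and a box; measurability and continuity in `y` are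
both read off from this. -/
lemma pi_truncPareto {α : ℝ} (hα : 0 < α) (y : ℝ) (m : ℕ) :
    Measure.pi (fun _ : Fin m => truncPareto α y)
      = (paretoMeasure 1 α (Icc 1 y))⁻¹ ^ m •
        (Measure.pi fun _ : Fin m => paretoMeasure 1 α).restrict (univ.pi fun _ => Icc 1 y) := by
  have := isProbabilityMeasure_paretoMeasure one_pos hα
  have : IsFiniteMeasure (truncPareto α y) := by unfold truncPareto; infer_instance
  refine Measure.pi_eq fun s hs => ?_
  rw [Measure.restrict_pi_pi, Measure.smul_apply, Measure.pi_pi]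
  simp [truncPareto, ProbabilityTheory.cond, Finset.prod_mul_distrib]

lemma truncParetoSumLaw_eq {α : ℝ} (hα : 0 < α) (y : ℝ) (m : ℕ) :
    truncParetoSumLaw α y m
      = (paretoMeasure 1 α (Icc 1 y))⁻¹ ^ m •
        ((Measure.pi fun _ : Fin m => paretoMeasure 1 α).restrict
          (univ.pi fun _ => Icc 1 y)).map fun v => ∑ i, v i := by
  rw [truncParetoSumLaw, pi_truncPareto hα, Measure.map_smul]

lemma lintegral_truncParetoSumLaw {α : ℝ} (hα : 0 < α) (y : ℝ) (m : ℕ) {g : ℝ → ENNReal}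
    (hg : Measurable g) :
    paretoMeasure 1 α (Icc 1 y) ^ m * ∫⁻ s, g s ∂truncParetoSumLaw α y m
      = ∫⁻ v in univ.pi fun _ => Icc 1 y, g (∑ i, v i)
          ∂(Measure.pi fun _ : Fin m => paretoMeasure 1 α) := by
  have := isProbabilityMeasure_paretoMeasure one_pos hα
  rw [truncParetoSumLaw_eq hα, lintegral_smul_measure, lintegral_map hg (measurable_sum_pi m),
    smul_eq_mul, ← mul_assoc, ← mul_pow]
  -- A null mass times its inverse is `0`, not `1`. Then the box is null if `m > 0`, and the zeroth
  -- power is `1` if `m = 0`.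
  by_cases h0 : paretoMeasure 1 α (Icc 1 y) = 0
  · rcases Nat.eq_zero_or_pos m with rfl | hm
    · simp
    · have : (Measure.pi fun _ : Fin m => paretoMeasure 1 α).restrict
          (univ.pi fun _ => Icc 1 y) = 0 := by
        rw [Measure.restrict_eq_zero, Measure.pi_pi]
        simp [h0, hm.ne']
      rw [this]
      simp
  · rw [ENNReal.mul_inv_cancel h0 (measure_ne_top _ _), one_pow, one_mul]

/-! ### Disintegration along the order statistic. -/

lemma measurePreserving_append (μ : Measure ℝ) [IsProbabilityMeasure μ] (m l : ℕ) :
    MeasurePreserving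
      (fun q : ℝ × (Fin m → ℝ) × (Fin l → ℝ) =>
        Fin.append (Fin.append q.2.1 fun _ : Fin 1 => q.1) q.2.2)
      (μ.prod ((Measure.pi fun _ : Fin m => μ).prod (Measure.pi fun _ : Fin l => μ)))
      (Measure.pi fun _ : Fin (m + 1 + l) => μ) := by
  have hm : Measurable fun q : ℝ × (Fin m → ℝ) × (Fin l → ℝ) =>
      (Fin.append (Fin.append q.2.1 fun _ : Fin 1 => q.1) q.2.2 : Fin (m + 1 + l) → ℝ) := by
    refine measurable_pi_lambda _ ?_
    simp only [Fin.forall_fin_add, Fin.append_left, Fin.append_right]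
    exact ⟨⟨fun i => by fun_prop, fun i => by fun_prop⟩, fun i => by fun_prop⟩
  refine ⟨hm, (Measure.pi_eq fun s hs => ?_).symm⟩
  rw [Measure.map_apply hm (MeasurableSet.univ_pi hs)]
  have : (fun q : ℝ × (Fin m → ℝ) × (Fin l → ℝ) =>
        (Fin.append (Fin.append q.2.1 fun _ : Fin 1 => q.1) q.2.2 : Fin (m + 1 + l) → ℝ)) ⁻¹'
        univ.pi s
      = s (Fin.castAdd l (Fin.natAdd m 0)) ×ˢ
        ((univ.pi fun i => s (Fin.castAdd l (Fin.castAdd 1 i))) ×ˢ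
          (univ.pi fun i => s (Fin.natAdd (m + 1) i))) := by
    ext q
    simp only [mem_preimage, mem_univ_pi, Fin.forall_fin_add, Fin.append_left, Fin.append_right,
      mem_prod, Fin.forall_fin_one]
    tauto
  rw [this, Measure.prod_prod, Measure.prod_prod, Measure.pi_pi, Measure.pi_pi,
    Fin.prod_univ_add, Fin.prod_univ_add]
  simp only [Fin.prod_univ_one]
  ring

/-- The position in `Fin (m + 1 + l)` with `m` predecessors and `l` successors. -/
def midIndex (m l : ℕ) : Fin (m + 1 + l) := Fin.castAdd l (Fin.natAdd m 0)

lemma sum_Iio_mid (m l : ℕ) (v : Fin (m + 1 + l) → ℝ) :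
    ∑ j ∈ Finset.Iio (midIndex m l), v j = ∑ i : Fin m, v (Fin.castAdd l (Fin.castAdd 1 i)) := by
  have : Finset.Iio (midIndex m l) = Finset.univ.filter (· < midIndex m l) := by ext; simp
  rw [this, Finset.sum_filter, Fin.sum_univ_add, Fin.sum_univ_add]
  simp [midIndex, Fin.lt_def, add_assoc]

/-- For fixed `z` the split set is a product, which is why the lower and upper blocks are
conditionally independent. -/
lemma append_mem_splitAt_iff (m l : ℕ) (z : ℝ) (a : Fin m → ℝ) (b : Fin l → ℝ) :
    (Fin.append (Fin.append a fun _ : Fin 1 => z) b : Fin (m + 1 + l) → ℝ)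
        ∈ splitAt (midIndex m l)
      ↔ (a, b) ∈ (univ.pi fun _ => Iio z) ×ˢ (univ.pi fun _ => Ioi z) := by
  simp only [splitAt, midIndex, mem_ofPred_eq, Fin.forall_fin_add, Fin.append_left,
    Fin.append_right, mem_prod, mem_univ_pi, mem_Iio, mem_Ioi]
  simp [Fin.lt_def, add_assoc]

/-- Fubini on the split set, with the middle coordinate `z` outermost: the upper block contributes
`μ(z,∞)^l`, the lower block `μ[1,z]^m` times the truncated sum law. -/
lemma lintegral_orderStat {α : ℝ} (hα : 0 < α) (m l : ℕ) {g : ℝ × ℝ → ENNReal}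
    (hg : Measurable g) :
    splitCount (midIndex m l) *
      ∫⁻ v, g (vecOrderStat v (midIndex m l),
          ∑ j ∈ Finset.Iio (midIndex m l), vecOrderStat v j)
        ∂(Measure.pi fun _ : Fin (m + 1 + l) => paretoMeasure 1 α)
      = (m + 1 + l).factorial *
        ∫⁻ z, paretoMeasure 1 α (Icc 1 z) ^ m * paretoMeasure 1 α (Ioi z) ^ l *
          ∫⁻ s, g (z, s) ∂truncParetoSumLaw α z m ∂(paretoMeasure 1 α) := by
  have := isProbabilityMeasure_paretoMeasure one_pos hα
  set μ := paretoMeasure 1 α with hμ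
  set p := midIndex m l with hp
  have hG : Measurable fun v : Fin (m + 1 + l) → ℝ =>
      g (vecOrderStat v p, ∑ j ∈ Finset.Iio p, vecOrderStat v j) :=
    hg.comp ((measurable_vecOrderStat p).prodMk
      (Finset.measurable_fun_sum _ fun j _ => measurable_vecOrderStat j))
  have hG' : Measurable fun v : Fin (m + 1 + l) → ℝ => g (v p, ∑ j ∈ Finset.Iio p, v j) :=
    hg.comp ((measurable_pi_apply p).prodMk
      (Finset.measurable_fun_sum _ fun j _ => measurable_pi_apply j))
  have hA := measurableSet_splitAt p
  rw [splitCount_mul_lintegral hG (fun v σ => by simp only [vecOrderStat_comp_perm]) p]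
  congr 1
  have h1 : ∫⁻ v in splitAt p, g (vecOrderStat v p, ∑ j ∈ Finset.Iio p, vecOrderStat v j)
        ∂(Measure.pi fun _ : Fin (m + 1 + l) => μ)
      = ∫⁻ v in splitAt p, g (v p, ∑ j ∈ Finset.Iio p, v j)
        ∂(Measure.pi fun _ : Fin (m + 1 + l) => μ) :=
    setLIntegral_congr_fun hA fun v hv => by
      simp only [vecOrderStat_of_mem_splitAt hv, sum_vecOrderStat_of_mem_splitAt hv]
  have hF := hG'.indicator hA
  rw [h1, ← lintegral_indicator hA, ← (measurePreserving_append μ m l).lintegral_comp hF]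
  refine (lintegral_prod _
    (hF.comp (measurePreserving_append μ m l).measurable).aemeasurable).trans ?_
  refine lintegral_congr fun z => ?_
  have hS : MeasurableSet ((univ.pi fun _ : Fin m => Iio z) ×ˢ (univ.pi fun _ : Fin l => Ioi z)) :=
    (MeasurableSet.univ_pi fun _ => measurableSet_Iio).prod
      (MeasurableSet.univ_pi fun _ => measurableSet_Ioi)
  have hgz : Measurable fun s => g (z, s) := hg.comp measurable_prodMk_left
  calc _ = ∫⁻ q in (univ.pi fun _ : Fin m => Iio z) ×ˢ (univ.pi fun _ : Fin l => Ioi z),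
          g (z, ∑ i, q.1 i) ∂((Measure.pi fun _ : Fin m => μ).prod
            (Measure.pi fun _ : Fin l => μ)) := by
        rw [← lintegral_indicator hS]
        refine lintegral_congr fun q => ?_
        simp only [Function.comp_apply]
        by_cases hq : q ∈ (univ.pi fun _ : Fin m => Iio z) ×ˢ (univ.pi fun _ : Fin l => Ioi z)
        · rw [indicator_of_mem hq, indicator_of_mem ((append_mem_splitAt_iff m l z q.1 q.2).2 hq),
            sum_Iio_mid]
          simp [hp, midIndex]
        · rw [indicator_of_notMem hq,
            indicator_of_notMem (mt (append_mem_splitAt_iff m l z q.1 q.2).1 hq)]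
    _ = ∫⁻ a in univ.pi fun _ : Fin m => Iio z, μ (Ioi z) ^ l * g (z, ∑ i, a i)
          ∂(Measure.pi fun _ : Fin m => μ) := by
        rw [← Measure.prod_restrict]
        refine (lintegral_prod _
          (hgz.comp ((measurable_sum_pi m).comp measurable_fst)).aemeasurable).trans ?_
        refine lintegral_congr fun a => ?_
        simp only [Function.comp_apply, lintegral_const, Measure.restrict_apply_univ,
          Measure.pi_pi, Finset.prod_const, Finset.card_univ, Fintype.card_fin]
        rw [mul_comm]
    _ = μ (Ioi z) ^ l * ∫⁻ a in univ.pi fun _ : Fin m => Icc 1 z, g (z, ∑ i, a i)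
          ∂(Measure.pi fun _ : Fin m => μ) := by
        rw [Measure.restrict_pi_pi, Measure.restrict_pi_pi,
          Measure.restrict_congr_set (pareto_Iio_ae_eq_Icc α z)]
        exact lintegral_const_mul _ (hgz.comp (measurable_sum_pi m))
    _ = _ := by
        rw [← lintegral_truncParetoSumLaw hα z m hgz]
        ring

/-! ### The conditional kernel and the regular conditional distribution. -/

/-- The kernel sending `y` to the law of the sum of `m` Pareto variables truncated at `y`. -/
noncomputable def truncParetoSumKernel {α : ℝ} (hα : 0 < α) (m : ℕ) : Kernel ℝ ℝ where
  toFun y := truncParetoSumLaw α y m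
  measurable' := by
    have := isProbabilityMeasure_paretoMeasure one_pos hα
    refine Measure.measurable_of_measurable_coe _ fun s hs => ?_
    -- Both factors are built from measures of sections at `y` of measurable sets, hence are
    -- measurable in `y`.
    simp only [truncParetoSumLaw_eq hα, Measure.smul_apply, smul_eq_mul]
    refine Measurable.mul ?_ ?_
    · refine Measurable.pow_const (Measurable.inv ?_) _
      have h : MeasurableSet {q : ℝ × ℝ | 1 ≤ q.2 ∧ q.2 ≤ q.1} :=
        (measurableSet_le measurable_const measurable_snd).inter
          (measurableSet_le measurable_snd measurable_fst)
      convert measurable_measure_prodMk_left (ν := paretoMeasure 1 α) h using 1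
      rfl
    · have h : MeasurableSet {q : ℝ × (Fin m → ℝ) |
          ∑ i, q.2 i ∈ s ∧ ∀ i, q.2 i ∈ Icc 1 q.1} := by
        refine (((measurable_sum_pi m).comp measurable_snd) hs).inter ?_
        change MeasurableSet {q : ℝ × (Fin m → ℝ) | ∀ i, q.2 i ∈ Icc 1 q.1}
        rw [ofPred_forall]
        refine MeasurableSet.iInter fun i => ?_
        have hi : Measurable fun q : ℝ × (Fin m → ℝ) => q.2 i := by fun_prop
        exact (measurableSet_le measurable_const hi).inter (measurableSet_le hi measurable_fst)
      convert measurable_measure_prodMk_left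
        (ν := Measure.pi fun _ : Fin m => paretoMeasure 1 α) h using 2 with y
      rw [Measure.map_apply (measurable_sum_pi m) hs,
        Measure.restrict_apply ((measurable_sum_pi m) hs)]
      congr 1
      ext v
      simp only [mem_inter_iff, mem_preimage, mem_univ_pi, mem_ofPred_eq]

/-- The bound must also cover `y ≤ 1`, where conditioning on a null set makes `truncPareto` zero. -/
instance {α : ℝ} (hα : 0 < α) (m : ℕ) : IsFiniteKernel (truncParetoSumKernel hα m) := by
  have := isProbabilityMeasure_paretoMeasure one_pos hα
  refine ⟨1, ENNReal.one_lt_top, fun y => ?_⟩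
  change truncParetoSumLaw α y m univ ≤ 1
  have : IsFiniteMeasure (truncPareto α y) := by unfold truncPareto; infer_instance
  rw [truncParetoSumLaw, Measure.map_apply (measurable_sum_pi m) MeasurableSet.univ,
    preimage_univ, Measure.pi_univ]
  refine Finset.prod_le_one' fun i _ => ?_
  rw [truncPareto, ProbabilityTheory.cond, Measure.smul_apply, Measure.restrict_apply_univ]
  exact ENNReal.inv_mul_le_one _

/-- The density, up to a constant factor, of the `(m + 1)`-th of `m + 1 + l` order statistics with
respect to the Pareto law. -/
noncomputable def orderStatDensity (α : ℝ) (m l : ℕ) (z : ℝ) : ENNReal :=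
  paretoMeasure 1 α (Icc 1 z) ^ m * paretoMeasure 1 α (Ioi z) ^ l

lemma measurable_orderStatDensity {α : ℝ} (hα : 0 < α) (m l : ℕ) :
    Measurable (orderStatDensity α m l) := by
  have := isProbabilityMeasure_paretoMeasure one_pos hα
  have h1 : Monotone fun z => paretoMeasure 1 α (Icc 1 z) := fun a b hab =>
    measure_mono (Icc_subset_Icc_right hab)
  have h2 : Antitone fun z => paretoMeasure 1 α (Ioi z) := fun a b hab =>
    measure_mono (Ioi_subset_Ioi hab)
  exact (h1.measurable.pow_const m).mul (h2.measurable.pow_const l)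

lemma ae_one_lt_pareto (α : ℝ) : ∀ᵐ z ∂paretoMeasure 1 α, 1 < z := by
  rw [ae_iff]
  simp only [not_lt]
  change paretoMeasure 1 α (Iic 1) = 0
  rw [← measure_congr (Iio_ae_eq_Iic (μ := paretoMeasure 1 α))]
  exact pareto_Iio_one α

lemma orderStat_eq_vecOrderStat {Ω : Type*} (X : ℕ → Ω → ℝ) (n : ℕ) (i : Fin n) (ω : Ω) :
    orderStat X n (i + 1) ω = vecOrderStat (fun i : Fin n => X i ω) i := by
  simp [orderStat, vecOrderStat]

lemma trimmedSum_eq_sum_vecOrderStat {Ω : Type*} (X : ℕ → Ω → ℝ) (m l : ℕ) (ω : Ω) :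
    trimmedSum X (m + 1 + l) (l + 1) ω
      = ∑ j ∈ Finset.Iio (midIndex m l),
          vecOrderStat (fun i : Fin (m + 1 + l) => X i ω) j := by
  have h : m + 1 + l - (l + 1) = m := by omega
  have hI : Finset.Icc 1 m = Finset.Ico (0 + 1) (m + 1) := by ext; simp
  rw [sum_Iio_mid, trimmedSum, h, hI,
    ← Finset.sum_Ico_add' (fun j => orderStat X (m + 1 + l) j ω) 0 m 1, ← Finset.range_eq_Ico,
    ← Fin.sum_univ_eq_sum_range (fun j => orderStat X (m + 1 + l) (j + 1) ω)]
  refine Finset.sum_congr rfl fun i _ => ?_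
  exact orderStat_eq_vecOrderStat X (m + 1 + l) (Fin.castAdd l (Fin.castAdd 1 i)) ω

lemma orderStat_mid {Ω : Type*} (X : ℕ → Ω → ℝ) (m l : ℕ) (ω : Ω) :
    orderStat X (m + 1 + l) (m + 1) ω
      = vecOrderStat (fun i : Fin (m + 1 + l) => X i ω) (midIndex m l) :=
  orderStat_eq_vecOrderStat X (m + 1 + l) (midIndex m l) ω

lemma measurable_orderStat_mid {Ω : Type*} [MeasurableSpace Ω] {X : ℕ → Ω → ℝ}
    (hmeas : ∀ i, Measurable (X i)) (m l : ℕ) :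
    Measurable (orderStat X (m + 1 + l) (m + 1)) := by
  have : orderStat X (m + 1 + l) (m + 1) = fun ω =>
    vecOrderStat (fun i : Fin (m + 1 + l) => X i ω) (midIndex m l) := funext (orderStat_mid X m l)
  rw [this]
  exact (measurable_vecOrderStat _).comp (measurable_pi_lambda _ fun i => hmeas i)

lemma map_orderStat_eq {Ω : Type*} [MeasurableSpace Ω] {P : Measure Ω} {α : ℝ}
    {X : ℕ → Ω → ℝ} (hmeas : ∀ i, Measurable (X i)) (hα : 0 < α) {m l : ℕ} {C : ENNReal}
    (hC : ∀ g : ℝ × ℝ → ENNReal, Measurable g →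
      ∫⁻ ω, g (orderStat X (m + 1 + l) (m + 1) ω, trimmedSum X (m + 1 + l) (l + 1) ω) ∂P
        = C * ∫⁻ z, orderStatDensity α m l z *
            ∫⁻ s, g (z, s) ∂truncParetoSumLaw α z m ∂(paretoMeasure 1 α)) :
    P.map (orderStat X (m + 1 + l) (m + 1))
      = C • (paretoMeasure 1 α).withDensity (orderStatDensity α m l) := by
  ext s hs
  have h := hC (fun q => s.indicator 1 q.1) ((measurable_one.indicator hs).comp measurable_fst)
  have h1 : ∫⁻ ω, s.indicator 1 (orderStat X (m + 1 + l) (m + 1) ω) ∂P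
      = P.map (orderStat X (m + 1 + l) (m + 1)) s := by
    rw [← lintegral_map (measurable_one.indicator hs) (measurable_orderStat_mid hmeas m l),
      lintegral_indicator_one hs]
  rw [← h1, h, Measure.smul_apply, withDensity_apply _ hs, smul_eq_mul, ← lintegral_indicator hs]
  congr 1
  refine lintegral_congr_ae ?_
  -- Only for `z > 1` is the inner law known to have total mass `1`.
  filter_upwards [ae_one_lt_pareto α] with z hz
  have := isProbabilityMeasure_truncParetoSumLaw hα hz m
  by_cases hzs : z ∈ s <;> simp [hzs]

section

variable {Ω : Type*} [MeasurableSpace Ω] {P : Measure Ω} [IsProbabilityMeasure P] {α : ℝ}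
  {X : ℕ → Ω → ℝ}

lemma measurable_trimmedSum (hmeas : ∀ i, Measurable (X i)) (m l : ℕ) :
    Measurable (trimmedSum X (m + 1 + l) (l + 1)) := by
  rw [funext (trimmedSum_eq_sum_vecOrderStat X m l)]
  exact Finset.measurable_fun_sum _ fun j _ =>
    (measurable_vecOrderStat j).comp (measurable_pi_lambda _ fun i => hmeas i)

lemma exists_lintegral_orderStat_trimmedSum (hα : 0 < α) (hmeas : ∀ i, Measurable (X i))
    (hindep : iIndepFun X P) (hlaw : ∀ i, P.map (X i) = paretoMeasure 1 α) (m l : ℕ) :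
    ∃ C : ENNReal, C ≠ 0 ∧ ∀ g : ℝ × ℝ → ENNReal, Measurable g →
      ∫⁻ ω, g (orderStat X (m + 1 + l) (m + 1) ω, trimmedSum X (m + 1 + l) (l + 1) ω) ∂P
        = C * ∫⁻ z, orderStatDensity α m l z *
            ∫⁻ s, g (z, s) ∂truncParetoSumLaw α z m ∂(paretoMeasure 1 α) := by
  have hc : (splitCount (midIndex m l) : ENNReal) ≠ 0 := by
    exact_mod_cast splitCount_ne_zero _
  have hc' : (splitCount (midIndex m l) : ENNReal) ≠ ⊤ := ENNReal.natCast_ne_top _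
  refine ⟨(splitCount (midIndex m l) : ENNReal)⁻¹ * (m + 1 + l).factorial, ?_, fun g hg => ?_⟩
  · refine mul_ne_zero (ENNReal.inv_ne_zero.2 hc') ?_
    exact_mod_cast (Nat.factorial_pos _).ne'
  · have hmap : P.map (fun ω (i : Fin (m + 1 + l)) => X i ω)
        = Measure.pi fun _ : Fin (m + 1 + l) => paretoMeasure 1 α := by
      have h := (iIndepFun_iff_map_fun_eq_pi_map
        (fun i : Fin (m + 1 + l) => (hmeas i).aemeasurable)).1
        (hindep.precomp (g := fun i : Fin (m + 1 + l) => (i : ℕ)) Fin.val_injective)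
      simpa only [hlaw] using h
    have hG : Measurable fun v : Fin (m + 1 + l) → ℝ => g (vecOrderStat v (midIndex m l),
          ∑ j ∈ Finset.Iio (midIndex m l), vecOrderStat v j) :=
      hg.comp ((measurable_vecOrderStat _).prodMk
        (Finset.measurable_fun_sum _ fun j _ => measurable_vecOrderStat j))
    have h := lintegral_orderStat hα m l hg
    rw [← hmap, lintegral_map hG (measurable_pi_lambda _ fun i => hmeas i)] at h
    simp only [orderStat_mid, trimmedSum_eq_sum_vecOrderStat]
    rw [mul_assoc]
    simp only [orderStatDensity]
    rw [← h, ← mul_assoc, ENNReal.inv_mul_cancel hc hc', one_mul]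

/-- The joint law and the law of the order statistic carry the same constant `C`, so its value is
irrelevant. -/
lemma map_orderStat_trimmedSum_eq_compProd (hα : 0 < α) (hmeas : ∀ i, Measurable (X i))
    (hindep : iIndepFun X P) (hlaw : ∀ i, P.map (X i) = paretoMeasure 1 α) (m l : ℕ) :
    P.map (fun ω => (orderStat X (m + 1 + l) (m + 1) ω, trimmedSum X (m + 1 + l) (l + 1) ω))
      = P.map (orderStat X (m + 1 + l) (m + 1)) ⊗ₘ truncParetoSumKernel hα m := by
  obtain ⟨C, -, hC⟩ := exists_lintegral_orderStat_trimmedSum hα hmeas hindep hlaw m l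
  have hpair := (measurable_orderStat_mid hmeas m l).prodMk (measurable_trimmedSum hmeas m l)
  ext s hs
  rw [Measure.compProd_apply hs, map_orderStat_eq hmeas hα hC, lintegral_smul_measure,
    lintegral_withDensity_eq_lintegral_mul _ (measurable_orderStatDensity hα m l)
      (Kernel.measurable_kernel_prodMk_left hs),
    ← lintegral_indicator_one hs, lintegral_map (measurable_one.indicator hs) hpair,
    hC _ (measurable_one.indicator hs), smul_eq_mul]
  congr 1
  refine lintegral_congr fun z => ?_
  simp only [Pi.mul_apply]
  congr 1
  exact lintegral_indicator_one (measurable_prodMk_left hs)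

lemma map_orderStat_Icc_ne_zero (hα : 0 < α) (hmeas : ∀ i, Measurable (X i))
    (hindep : iIndepFun X P) (hlaw : ∀ i, P.map (X i) = paretoMeasure 1 α) (m l : ℕ)
    {y ε : ℝ} (hy : 1 < y) (hε : 0 < ε) :
    P.map (orderStat X (m + 1 + l) (m + 1)) (Icc (y - ε) (y + ε)) ≠ 0 := by
  obtain ⟨C, hC0, hC⟩ := exists_lintegral_orderStat_trimmedSum hα hmeas hindep hlaw m l
  rw [map_orderStat_eq hmeas hα hC, Measure.smul_apply, smul_eq_mul]
  refine mul_ne_zero hC0 ?_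
  rw [Ne, withDensity_apply_eq_zero (measurable_orderStatDensity hα m l)]
  -- The right half of the interval suffices, and there `z > 1` makes both factors of the density
  -- positive.
  have hsub : Ioo y (y + ε) ⊆ {z | orderStatDensity α m l z ≠ 0} ∩ Icc (y - ε) (y + ε) := by
    refine fun z hz => ⟨?_, by linarith [hz.1], hz.2.le⟩
    exact mul_ne_zero (pow_ne_zero _ (pareto_Icc_pos hα (hy.trans hz.1)).ne')
      (pow_ne_zero _ (pareto_Ioi_pos hα z).ne')
  exact ((pareto_Ioo_pos hα hy.le (lt_add_of_pos_right y hε)).trans_le (measure_mono hsub)).ne'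

lemma condDistrib_trimmedSum_ae_eq (hα : 0 < α) (hmeas : ∀ i, Measurable (X i))
    (hindep : iIndepFun X P) (hlaw : ∀ i, P.map (X i) = paretoMeasure 1 α) (m l : ℕ) :
    ∀ᵐ y ∂(P.map (orderStat X (m + 1 + l) (m + 1))),
      condDistrib (trimmedSum X (m + 1 + l) (l + 1)) (orderStat X (m + 1 + l) (m + 1)) P y
        = truncParetoSumLaw α y m :=
  condDistrib_ae_eq_of_measure_eq_compProd (κ := truncParetoSumKernel hα m) _
    (measurable_trimmedSum hmeas m l).aemeasurable
    (map_orderStat_trimmedSum_eq_compProd hα hmeas hindep hlaw m l)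

end

/-! ### Elementary conditioning at a point. -/

/-- Dominated convergence: unless some coordinate equals `y`, a null event, the indicator of the box
is constant for `z` near `y`. -/
lemma continuousAt_setIntegral_box {μ : Measure ℝ} [IsProbabilityMeasure μ]
    [NullSingletonClass μ] {m : ℕ} {F : (Fin m → ℝ) → ℝ} (hF : Measurable F) {b : ℝ}
    (hb : ∀ v, ‖F v‖ ≤ b) (y : ℝ) :
    ContinuousAt (fun z => ∫ v in univ.pi fun _ : Fin m => Icc 1 z, F v
      ∂(Measure.pi fun _ : Fin m => μ)) y := by
  have hbox (z : ℝ) : MeasurableSet (univ.pi fun _ : Fin m => Icc 1 z) :=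
    MeasurableSet.univ_pi fun _ => measurableSet_Icc
  simp only [← integral_indicator (hbox _)]
  refine continuousAt_of_dominated (bound := fun _ => b) (Eventually.of_forall fun z =>
    (hF.indicator (hbox z)).aestronglyMeasurable) (Eventually.of_forall fun z =>
    Eventually.of_forall fun v => (norm_indicator_le_norm_self F v).trans (hb v))
    (integrable_const b) ?_
  have hne : ∀ᵐ v ∂(Measure.pi fun _ : Fin m => μ), ∀ i, v i ≠ y := by
    rw [ae_all_iff]
    intro i
    rw [ae_iff]
    simp only [ne_eq, not_not]
    exact Measure.pi_eval_preimage_null (fun _ : Fin m => μ) (measure_singleton y)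
  filter_upwards [hne] with v hv
  have h : ∀ᶠ z in 𝓝 y, ∀ i, (v i ∈ Icc 1 z ↔ v i ∈ Icc 1 y) := by
    rw [eventually_all]
    intro i
    rcases lt_or_gt_of_ne (hv i) with h | h
    · filter_upwards [eventually_gt_nhds h] with z hz
      simp [hz.le, h.le]
    · filter_upwards [eventually_lt_nhds h] with z hz
      simp [not_le.2 hz, not_le.2 h]
  refine ContinuousAt.congr (f := fun _ => (univ.pi fun _ : Fin m => Icc 1 y).indicator F v)
    continuousAt_const ?_
  filter_upwards [h] with z hz
  have : v ∈ (univ.pi fun _ : Fin m => Icc 1 z) ↔ v ∈ univ.pi fun _ : Fin m => Icc 1 y := by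
    simp only [mem_univ_pi, hz]
  by_cases hz : v ∈ univ.pi fun _ : Fin m => Icc 1 y
  · rw [indicator_of_mem hz, indicator_of_mem (this.2 hz)]
  · rw [indicator_of_notMem hz, indicator_of_notMem (mt this.1 hz)]

lemma integral_truncParetoSumLaw {α : ℝ} (hα : 0 < α) (y : ℝ) (m : ℕ) {f : ℝ → ℝ}
    (hf : Measurable f) :
    ∫ t, f t ∂truncParetoSumLaw α y m
      = ((paretoMeasure 1 α).real (Icc 1 y))⁻¹ ^ m *
        ∫ v in univ.pi fun _ => Icc 1 y, f (∑ i, v i)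
          ∂(Measure.pi fun _ : Fin m => paretoMeasure 1 α) := by
  rw [truncParetoSumLaw_eq hα, integral_smul_measure, integral_map
    (measurable_sum_pi m).aemeasurable hf.aestronglyMeasurable]
  simp [measureReal_def, ENNReal.toReal_pow, ENNReal.toReal_inv]

lemma continuousAt_integral_truncParetoSumLaw {α y : ℝ} (hα : 0 < α) (hy : 1 < y) (m : ℕ)
    (f : ℝ →ᵇ ℝ) : ContinuousAt (fun z => ∫ t, f t ∂truncParetoSumLaw α z m) y := by
  have := isProbabilityMeasure_paretoMeasure one_pos hα
  have hf : Measurable f := f.continuous.measurable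
  simp only [integral_truncParetoSumLaw hα _ m hf]
  refine ContinuousAt.mul ((ContinuousAt.inv₀ ?_ ?_).pow m) ?_
  -- The normalising mass is itself a box integral, with `m = 1` and `F = 1`.
  · have h := continuousAt_setIntegral_box (μ := paretoMeasure 1 α) (m := 1) (F := fun _ => 1)
      measurable_const (b := 1) (by simp) y
    simpa [measureReal_def, Measure.pi_pi, -pi_univ_Icc] using h
  · exact (ENNReal.toReal_pos (pareto_Icc_pos hα hy).ne' (measure_ne_top _ _)).ne'
  · exact continuousAt_setIntegral_box (hf.comp (measurable_sum_pi m)) (b := ‖f‖)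
      (fun v => f.norm_coe_le_norm _) y

/-- Elementary conditional expectations converge at the continuity points of a disintegration. -/
lemma tendsto_integral_cond_of_compProd {Ω : Type*} [MeasurableSpace Ω] {P : Measure Ω}
    [IsProbabilityMeasure P] {T Z : Ω → ℝ} (hT : Measurable T) (hZ : Measurable Z)
    {κ : Kernel ℝ ℝ} [IsFiniteKernel κ] (h : P.map (fun ω => (Z ω, T ω)) = P.map Z ⊗ₘ κ) {y : ℝ}
    (hpos : ∀ ε : ℝ, 0 < ε → P (Z ⁻¹' Icc (y - ε) (y + ε)) ≠ 0) (f : ℝ →ᵇ ℝ)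
    (hcont : ContinuousAt (fun z => ∫ t, f t ∂κ z) y) :
    Tendsto (fun ε : ℝ => ∫ ω, f (T ω) ∂(ProbabilityTheory.cond P (Z ⁻¹' Icc (y - ε) (y + ε))))
      (𝓝[>] 0) (𝓝 (∫ t, f t ∂κ y)) := by
  set φ : ℝ → ℝ := fun z => ∫ t, f t ∂κ z with hφ
  have hprob := Measure.isProbabilityMeasure_map (μ := P) hZ.aemeasurable
  have hfT : StronglyMeasurable fun q : ℝ × ℝ => f q.2 :=
    (f.continuous.comp continuous_snd).stronglyMeasurable
  have hint : Integrable (fun q : ℝ × ℝ => f q.2) (P.map Z ⊗ₘ κ) := by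
    rw [← h]
    have := Measure.isProbabilityMeasure_map (μ := P) (hZ.prodMk hT).aemeasurable
    exact (integrable_const ‖f‖).mono' hfT.aestronglyMeasurable
      (ae_of_all _ fun q => f.norm_coe_le_norm _)
  have hφint : Integrable φ (P.map Z) := hint.integral_compProd
  -- By the disintegration, the conditional expectation is an average of `φ` over a shrinking
  -- interval around its continuity point `y`.
  have key (ε : ℝ) : ∫ ω, f (T ω) ∂(ProbabilityTheory.cond P (Z ⁻¹' Icc (y - ε) (y + ε)))
      = ∫ z, φ z ∂(ProbabilityTheory.cond (P.map Z) (Icc (y - ε) (y + ε))) := by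
    have h1 : ∫ ω in Z ⁻¹' Icc (y - ε) (y + ε), f (T ω) ∂P
        = ∫ z in Icc (y - ε) (y + ε), φ z ∂(P.map Z) := by
      have h2 := Measure.setIntegral_compProd (κ := κ) (μ := P.map Z)
        (measurableSet_Icc (a := y - ε) (b := y + ε)) MeasurableSet.univ
        (f := fun q : ℝ × ℝ => f q.2) hint.integrableOn
      rw [← h, setIntegral_map (measurableSet_Icc.prod MeasurableSet.univ)
        hfT.aestronglyMeasurable (hZ.prodMk hT).aemeasurable] at h2
      simp only [Measure.restrict_univ] at h2
      rw [← h2]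
      congr 2
      ext ω
      simp
    rw [ProbabilityTheory.cond, ProbabilityTheory.cond, integral_smul_measure,
      integral_smul_measure, h1, Measure.map_apply hZ measurableSet_Icc]
  simp only [key]
  rw [Metric.tendsto_nhds]
  intro δ hδ
  obtain ⟨r, hr, hr'⟩ := Metric.continuousAt_iff.1 hcont (δ / 2) (half_pos hδ)
  filter_upwards [Ioo_mem_nhdsGT hr] with ε hε
  have hne : P.map Z (Icc (y - ε) (y + ε)) ≠ 0 := by
    rw [Measure.map_apply hZ measurableSet_Icc]
    exact hpos ε hε.1
  have := cond_isProbabilityMeasure hne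
  have hφint' : Integrable φ (ProbabilityTheory.cond (P.map Z) (Icc (y - ε) (y + ε))) :=
    hφint.integrableOn.smul_measure (ENNReal.inv_ne_top.2 hne)
  have hsub : (∫ z, φ z ∂(ProbabilityTheory.cond (P.map Z) (Icc (y - ε) (y + ε)))) - φ y
      = ∫ z, (φ z - φ y) ∂(ProbabilityTheory.cond (P.map Z) (Icc (y - ε) (y + ε))) := by
    rw [integral_sub hφint' (integrable_const _)]
    simp
  rw [dist_eq_norm, hsub]
  refine lt_of_le_of_lt (norm_integral_le_of_norm_le_const (C := δ / 2) ?_) (by simp; linarith)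
  filter_upwards [ae_cond_mem measurableSet_Icc] with z hz
  rw [← dist_eq_norm]
  refine (hr' ?_).le
  rw [Real.dist_eq, abs_lt]
  constructor <;> linarith [hz.1, hz.2, hε.2]

lemma IsCondLawAt.unique {Ω : Type*} [MeasurableSpace Ω] {P : Measure Ω}
    {T Z : Ω → ℝ} {y : ℝ} {ν ν' : Measure ℝ}
    (h : IsCondLawAt P T Z y ν) (h' : IsCondLawAt P T Z y ν') : ν = ν' := by
  have := h.1
  have := h'.1
  exact ext_of_forall_integral_eq_of_IsFiniteMeasure fun f =>
    tendsto_nhds_unique (h.2.2 f) (h'.2.2 f)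

section

variable {Ω : Type*} [MeasurableSpace Ω] {P : Measure Ω} [IsProbabilityMeasure P] {α : ℝ}
  {X : ℕ → Ω → ℝ}

lemma isCondLawAt_trimmedSum (hα : 0 < α) (hmeas : ∀ i, Measurable (X i))
    (hindep : iIndepFun X P) (hlaw : ∀ i, P.map (X i) = paretoMeasure 1 α) (m l : ℕ)
    {y : ℝ} (hy : 1 < y) :
    IsCondLawAt P (trimmedSum X (m + 1 + l) (l + 1)) (orderStat X (m + 1 + l) (m + 1)) y
      (truncParetoSumLaw α y m) := by
  have hZ := measurable_orderStat_mid hmeas m l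
  have hpos : ∀ ε : ℝ, 0 < ε →
      P (orderStat X (m + 1 + l) (m + 1) ⁻¹' Icc (y - ε) (y + ε)) ≠ 0 := fun ε hε => by
    rw [← Measure.map_apply hZ measurableSet_Icc]
    exact map_orderStat_Icc_ne_zero hα hmeas hindep hlaw m l hy hε
  exact ⟨isProbabilityMeasure_truncParetoSumLaw hα hy m, hpos, fun f =>
    tendsto_integral_cond_of_compProd (measurable_trimmedSum hmeas m l) hZ
      (map_orderStat_trimmedSum_eq_compProd hα hmeas hindep hlaw m l) hpos f
      (continuousAt_integral_truncParetoSumLaw hα hy m f)⟩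

lemma isCondLawAt_trimmedSum_iff (hα : 0 < α) (hmeas : ∀ i, Measurable (X i))
    (hindep : iIndepFun X P) (hlaw : ∀ i, P.map (X i) = paretoMeasure 1 α) (m l : ℕ)
    {y : ℝ} (hy : 1 < y) (ν : Measure ℝ) :
    IsCondLawAt P (trimmedSum X (m + 1 + l) (l + 1)) (orderStat X (m + 1 + l) (m + 1)) y ν
      ↔ ν = truncParetoSumLaw α y m := by
  have h := isCondLawAt_trimmedSum hα hmeas hindep hlaw m l hy
  exact ⟨fun h' => h'.unique h, fun h' => h' ▸ h⟩

end

/-! ### Moments of truncated Pareto variables and of their sums. -/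

lemma setIntegral_pareto {α : ℝ} (hα : 0 < α) {y : ℝ} (hy : 1 < y) (f : ℝ → ℝ) :
    ∫ x in Icc 1 y, f x ∂paretoMeasure 1 α = ∫ x in (1 : ℝ)..y, α * x ^ (-(α + 1)) * f x := by
  have hm : Measurable (paretoPDF 1 α) := (measurable_paretoPDFReal 1 α).ennreal_ofReal
  rw [paretoMeasure, setIntegral_withDensity_eq_setIntegral_toReal_smul hm
    (ae_of_all _ fun _ => ENNReal.ofReal_lt_top) _ measurableSet_Icc, integral_Icc_eq_integral_Ioc,
    intervalIntegral.integral_of_le hy.le]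
  refine setIntegral_congr_fun measurableSet_Ioc fun x hx => ?_
  simp only [paretoPDF, smul_eq_mul]
  rw [ENNReal.toReal_ofReal (paretoPDFReal_nonneg zero_le_one hα.le x), paretoPDFReal,
    if_pos hx.1.le, Real.one_rpow, mul_one]

/-- The values `q = 0, 1, 2` give the mass, mean and second moment; the exceptional cases `α = 1, 2`
come from the logarithm at `α = q`. -/
lemma setIntegral_pareto_pow {α : ℝ} (hα : 0 < α) {y : ℝ} (hy : 1 < y) (q : ℕ) :
    ∫ x in Icc 1 y, x ^ q ∂paretoMeasure 1 α
      = if α = q then α * Real.log y else (1 - y ^ (q - α)) / (1 - q / α) := by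
  have h0 : (0 : ℝ) ∉ uIcc 1 y := by
    rw [uIcc_of_le hy.le]
    exact fun h => absurd h.1 (by norm_num)
  have h1 : ∫ x in (1 : ℝ)..y, α * x ^ (-(α + 1)) * x ^ q
      = α * ∫ x in (1 : ℝ)..y, x ^ (q - α - 1) := by
    rw [← intervalIntegral.integral_const_mul]
    refine intervalIntegral.integral_congr fun x hx => ?_
    rw [uIcc_of_le hy.le] at hx
    have hx0 : 0 < x := one_pos.trans_le hx.1
    rw [mul_assoc, ← Real.rpow_natCast x q, ← Real.rpow_add hx0]
    congr 2
    ring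
  rw [setIntegral_pareto hα hy, h1]
  split_ifs with h
  · have : (q : ℝ) - α - 1 = -1 := by rw [h]; ring
    simp only [this, Real.rpow_neg_one]
    rw [integral_inv h0, div_one]
  · have hq : (q : ℝ) - α ≠ 0 := sub_ne_zero.2 (Ne.symm h)
    rw [integral_rpow (Or.inr ⟨fun h' => hq (by linarith), h0⟩), sub_add_cancel, Real.one_rpow]
    have h2 : 1 - (q : ℝ) / α ≠ 0 := by
      rw [one_sub_div hα.ne']
      exact div_ne_zero (sub_ne_zero.2 h) hα.ne'
    have h3 : α - (q : ℝ) ≠ 0 := sub_ne_zero.2 h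
    field_simp
    ring

lemma pareto_real_Icc {α : ℝ} (hα : 0 < α) {y : ℝ} (hy : 1 < y) :
    (paretoMeasure 1 α).real (Icc 1 y) = 1 - y ^ (-α) := by
  have h := setIntegral_pareto_pow hα hy 0
  simpa [hα.ne'] using h

lemma integral_truncPareto_pow {α : ℝ} (hα : 0 < α) {y : ℝ} (hy : 1 < y) (q : ℕ) :
    ∫ x, x ^ q ∂truncPareto α y = (1 - y ^ (-α))⁻¹ *
      if α = q then α * Real.log y else (1 - y ^ (q - α)) / (1 - q / α) := by
  rw [truncPareto, ProbabilityTheory.cond, integral_smul_measure, setIntegral_pareto_pow hα hy,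
    ENNReal.toReal_inv, ← measureReal_def, pareto_real_Icc hα hy, smul_eq_mul]

/-- The choice `n = 1`, `k = 0` is the closed form for a single summand. -/
lemma trimmedMean_eq (α : ℝ) (n k : ℕ) (y : ℝ) :
    trimmedMean α n k y = ((n : ℝ) - k) * trimmedMean α 1 0 y := by
  simp only [trimmedMean, Nat.cast_one, Nat.cast_zero, sub_zero]
  ring

lemma trimmedVar_eq (α : ℝ) (n k : ℕ) (y : ℝ) :
    trimmedVar α n k y = ((n : ℝ) - k) * trimmedVar α 1 0 y := by
  simp only [trimmedVar, Nat.cast_one, Nat.cast_zero, sub_zero]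
  split_ifs <;> ring

lemma memLp_truncPareto {α : ℝ} (hα : 0 < α) {y : ℝ} (hy : 1 < y) :
    MemLp (fun t : ℝ => t) 2 (truncPareto α y) := by
  have := isProbabilityMeasure_truncPareto hα hy
  refine MemLp.of_bound aestronglyMeasurable_id y ?_
  filter_upwards [ae_cond_mem (μ := paretoMeasure 1 α) (measurableSet_Icc (a := 1) (b := y))]
    with x hx
  rw [Real.norm_eq_abs, abs_of_nonneg (zero_le_one.trans hx.1)]
  exact hx.2

lemma integral_truncPareto {α : ℝ} (hα : 0 < α) {y : ℝ} (hy : 1 < y) :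
    ∫ t, t ∂truncPareto α y = trimmedMean α 1 0 y := by
  have h := integral_truncPareto_pow hα hy 1
  simp only [pow_one, Nat.cast_one] at h
  rw [h, trimmedMean]
  split_ifs with h1
  · simp [h1]
  · simp

lemma variance_truncPareto {α : ℝ} (hα : 0 < α) {y : ℝ} (hy : 1 < y) :
    variance (fun t : ℝ => t) (truncPareto α y) = trimmedVar α 1 0 y := by
  have := isProbabilityMeasure_truncPareto hα hy
  have h2 := integral_truncPareto_pow hα hy 2
  have hy0 : 0 < y := one_pos.trans hy
  have hy1 : y - 1 ≠ 0 := (sub_pos.2 hy).ne'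
  rw [variance_eq_sub (memLp_truncPareto hα hy)]
  simp only [Pi.pow_apply]
  rw [h2, integral_truncPareto hα hy]
  simp only [trimmedMean, trimmedVar, Nat.cast_one, Nat.cast_zero, sub_zero, Nat.cast_ofNat]
  by_cases h1 : α = 1
  · subst h1
    have hm : y ^ (-1 : ℝ) = y⁻¹ := Real.rpow_neg_one y
    have he : y ^ ((2 : ℝ) - 1) = y := by norm_num
    rw [if_neg (by norm_num), if_pos rfl, if_pos rfl, hm, he]
    have : 1 - y⁻¹ = (y - 1) / y := by field_simp
    rw [this]
    field_simp
    ring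
  · by_cases h2 : α = 2
    · subst h2
      have hm : y ^ (-2 : ℝ) = (y ^ 2)⁻¹ := by
        rw [Real.rpow_neg hy0.le]
        norm_num
      have he : y ^ ((1 : ℝ) - 2) = y⁻¹ := by
        rw [← Real.rpow_neg_one]
        norm_num
      rw [if_pos rfl, if_neg h1, if_neg h1, if_pos rfl, hm, he]
      have hp : y + 1 ≠ 0 := by positivity
      have e1 : 1 - (y ^ 2)⁻¹ = (y - 1) * (y + 1) / y ^ 2 := by field_simp; ring
      have e2 : 1 - y⁻¹ = (y - 1) / y := by field_simp
      have e3 : y ^ 2 - 1 = (y - 1) * (y + 1) := by ring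
      rw [e1, e2, e3]
      field_simp
      ring
    · rw [if_neg h2, if_neg h1, if_neg h1, if_neg h2]
      generalize 1 - 1 / α = d
      ring

/-- Zero variance would concentrate the truncated law at its mean, but it has no atoms. -/
lemma trimmedVar_one_pos {α : ℝ} (hα : 0 < α) {y : ℝ} (hy : 1 < y) :
    0 < trimmedVar α 1 0 y := by
  have := isProbabilityMeasure_truncPareto hα hy
  rw [← variance_truncPareto hα hy]
  refine lt_of_le_of_ne (variance_nonneg _ _) fun h => ?_
  have h1 := ae_eq_integral_of_variance_eq_zero (memLp_truncPareto hα hy) h.symm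
  have h2 : truncPareto α y {∫ t, t ∂truncPareto α y} = 0 :=
    cond_absolutelyContinuous (measure_singleton _)
  rw [ae_iff] at h1
  have h3 : truncPareto α y univ = 0 := by
    rw [← compl_union_self {∫ t, t ∂truncPareto α y}]
    exact measure_union_null h1 h2
  simp at h3

lemma memLp_truncParetoSumLaw {α : ℝ} (hα : 0 < α) {y : ℝ} (hy : 1 < y) (m : ℕ) :
    MemLp (fun t : ℝ => t) 2 (truncParetoSumLaw α y m) := by
  have := isProbabilityMeasure_truncPareto hα hy
  rw [truncParetoSumLaw, memLp_map_measure_iff (g := fun t : ℝ => t) aestronglyMeasurable_id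
    (measurable_sum_pi m).aemeasurable]
  exact memLp_finsetSum _ fun i _ => (memLp_truncPareto hα hy).comp_measurePreserving
    (measurePreserving_eval (fun _ : Fin m => truncPareto α y) i)

lemma integral_id_truncParetoSumLaw {α : ℝ} (hα : 0 < α) {y : ℝ} (hy : 1 < y) (m : ℕ) :
    ∫ t, t ∂truncParetoSumLaw α y m = m * trimmedMean α 1 0 y := by
  have := isProbabilityMeasure_truncPareto hα hy
  rw [truncParetoSumLaw, integral_map (f := fun t : ℝ => t)
    (measurable_sum_pi m).aemeasurable aestronglyMeasurable_id, integral_finsetSum]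
  · simp [integral_comp_eval (μ := fun _ : Fin m => truncPareto α y) (f := fun t : ℝ => t)
      aestronglyMeasurable_id, integral_truncPareto hα hy]
  · intro i _
    exact integrable_comp_eval (μ := fun _ : Fin m => truncPareto α y) (i := i)
      ((memLp_truncPareto hα hy).integrable one_le_two)

lemma variance_id_truncParetoSumLaw {α : ℝ} (hα : 0 < α) {y : ℝ} (hy : 1 < y) (m : ℕ) :
    variance (fun t : ℝ => t) (truncParetoSumLaw α y m) = m * trimmedVar α 1 0 y := by
  have := isProbabilityMeasure_truncPareto hα hy
  rw [truncParetoSumLaw, variance_map (X := fun t : ℝ => t) aemeasurable_id (measurable_sum_pi m).aemeasurable]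
  have h := variance_sum_pi (μ := fun _ : Fin m => truncPareto α y) (X := fun _ t => t)
    fun _ => memLp_truncPareto hα hy
  have he : (∑ i : Fin m, fun v : Fin m → ℝ => v i)
      = (fun t : ℝ => t) ∘ fun v : Fin m → ℝ => ∑ i, v i := by
    ext v
    simp
  rw [he] at h
  rw [h]
  simp [variance_truncPareto hα hy]

/-! ### Central limit theorem and uniform convergence of distribution functions. -/

/-- **Pólya's theorem**: pointwise convergence of distribution functions to a continuous one is
uniform. -/
lemma eventually_forall_abs_sub_lt_of_tendsto {F : ℕ → ℝ → ℝ} {G : ℝ → ℝ}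
    (hF : ∀ n, Monotone (F n)) (hF0 : ∀ n x, 0 ≤ F n x) (hF1 : ∀ n x, F n x ≤ 1)
    (hG : Monotone G) (hcont : Continuous G) (hbot : Tendsto G atBot (𝓝 0))
    (htop : Tendsto G atTop (𝓝 1)) (h : ∀ x, Tendsto (fun n => F n x) atTop (𝓝 (G x)))
    {ε : ℝ} (hε : 0 < ε) : ∀ᶠ n in atTop, ∀ x, |F n x - G x| < ε := by
  have hG0 (x : ℝ) : 0 ≤ G x := hG.le_of_tendsto hbot x
  have hG1 (x : ℝ) : G x ≤ 1 := hG.ge_of_tendsto htop x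
  -- Outside `[a, b]` both functions lie within `ε` of the same limit value by monotonicity; only
  -- the compact part needs an argument.
  obtain ⟨a, ha⟩ := (hbot.eventually_lt_const hε).exists
  obtain ⟨b, hb⟩ := (htop.eventually_const_lt (sub_lt_self 1 hε)).exists
  have hloc : TendstoLocallyUniformlyOn F G atTop (Icc a b) := by
    rw [Metric.tendstoLocallyUniformlyOn_iff]
    intro δ hδ x _
    -- Error budget: `δ / 2` for `F n` against `G` at an endpoint, and twice `δ / 4` for the
    -- variation of `G` between endpoints.
    obtain ⟨r, hr, hr'⟩ := Metric.continuousAt_iff.1 (hcont.continuousAt (x := x)) (δ / 4)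
      (by linarith)
    have hu := @hr' (x - r / 2) (by rw [Real.dist_eq, abs_lt]; constructor <;> linarith)
    have hw := @hr' (x + r / 2) (by rw [Real.dist_eq, abs_lt]; constructor <;> linarith)
    rw [Real.dist_eq, abs_lt] at hu hw
    refine ⟨Icc (x - r / 2) (x + r / 2),
      mem_nhdsWithin_of_mem_nhds (Icc_mem_nhds (by linarith) (by linarith)), ?_⟩
    filter_upwards [(h (x - r / 2)).eventually (Metric.ball_mem_nhds _ (half_pos hδ)),
      (h (x + r / 2)).eventually (Metric.ball_mem_nhds _ (half_pos hδ))] with n h1 h2 z hz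
    rw [Real.dist_eq, abs_lt] at h1 h2
    rw [Real.dist_eq, abs_lt]
    have := hF n hz.1
    have := hF n hz.2
    have := hG hz.1
    have := hG hz.2
    constructor <;> linarith [hu.1, hu.2, hw.1, hw.2, h1.1, h1.2, h2.1, h2.2]
  have hunif := (tendstoLocallyUniformlyOn_iff_tendstoUniformlyOn_of_compact isCompact_Icc).1 hloc
  filter_upwards [Metric.tendstoUniformlyOn_iff.1 hunif ε hε, (h a).eventually_lt_const ha,
    (h b).eventually_const_lt hb] with n h1 h2 h3 x
  rw [abs_lt]
  rcases le_total x a with hx | hx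
  · have := hF n hx
    have := hG hx
    constructor <;> linarith [hF0 n x, hG0 x]
  rcases le_total b x with hx' | hx'
  · have := hF n hx'
    have := hG hx'
    constructor <;> linarith [hF1 n x, hG1 x]
  · have := h1 x ⟨hx, hx'⟩
    rw [dist_comm, Real.dist_eq, abs_lt] at this
    exact this

/-- The jump of the distribution function at `x` is the mass of `{x}`. -/
lemma continuous_cdf_of_nullSingletonClass (μ : Measure ℝ) [IsProbabilityMeasure μ]
    [NullSingletonClass μ] : Continuous (cdf μ) := by
  rw [continuous_iff_continuousAt]
  intro x
  rw [(monotone_cdf μ).continuousAt_iff_leftLim_eq_rightLim, StieltjesFunction.rightLim_eq]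
  have h : (cdf μ).measure {x} = 0 := by rw [measure_cdf, measure_singleton]
  rw [StieltjesFunction.measure_singleton, ENNReal.ofReal_eq_zero, sub_nonpos] at h
  exact le_antisymm ((monotone_cdf μ).leftLim_le le_rfl) h

/-- Realises all the sum laws on one probability space, as the central limit theorem requires. -/
lemma map_sum_infinitePi_truncPareto {α : ℝ} (hα : 0 < α) {y : ℝ} (hy : 1 < y) (m : ℕ) :
    (Measure.infinitePi fun _ : ℕ => truncPareto α y).map
      (fun ω => ∑ i ∈ Finset.range m, ω i) = truncParetoSumLaw α y m := by
  have := isProbabilityMeasure_truncPareto hα hy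
  have hind : iIndepFun (fun (i : ℕ) (ω : ℕ → ℝ) => ω i)
      (Measure.infinitePi fun _ : ℕ => truncPareto α y) :=
    iIndepFun_infinitePi (X := fun _ x => x) fun _ => measurable_id
  have h := (iIndepFun_iff_map_fun_eq_pi_map
    (fun i : Fin m => (measurable_pi_apply (i : ℕ)).aemeasurable)).1
    (hind.precomp (g := fun i : Fin m => (i : ℕ)) Fin.val_injective)
  simp only [Measure.infinitePi_map_eval] at h
  rw [truncParetoSumLaw, ← h, Measure.map_map (measurable_sum_pi m)
    (measurable_pi_lambda _ fun i => measurable_pi_apply _)]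
  congr 1
  ext ω
  exact (Fin.sum_univ_eq_sum_range ω m).symm

/-- The central limit theorem for sums of truncated Pareto variables. -/
lemma tendsto_truncParetoSumLaw {α : ℝ} (hα : 0 < α) {y : ℝ} (hy : 1 < y) (x : ℝ) :
    Tendsto (fun m : ℕ => (truncParetoSumLaw α y m).real
        {t | (t - m * trimmedMean α 1 0 y) / √(m * trimmedVar α 1 0 y) ≤ x})
      atTop (𝓝 ((gaussianReal 0 1).real (Iic x))) := by
  have := isProbabilityMeasure_truncPareto hα hy
  set Q := Measure.infinitePi fun _ : ℕ => truncPareto α y with hQ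
  set a := trimmedMean α 1 0 y with ha
  set V := trimmedVar α 1 0 y with hV
  have hVpos : 0 < V := trimmedVar_one_pos hα hy
  have hmp (i : ℕ) : MeasurePreserving (fun ω : ℕ → ℝ => ω i) Q (truncPareto α y) :=
    measurePreserving_eval_infinitePi _ i
  have hL := memLp_truncPareto hα hy
  have hLi : Integrable (fun t : ℝ => t) (truncPareto α y) := hL.integrable one_le_two
  let W : ℕ → (ℕ → ℝ) → ℝ := fun i ω => (ω i - a) / √V
  have hg : Measurable fun t : ℝ => (t - a) / √V := by fun_prop
  have hW0 : Q[W 0] = 0 := by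
    have : ∫ ω, W 0 ω ∂Q = ∫ t, (t - a) / √V ∂truncPareto α y := by
      rw [← (hmp 0).map_eq, integral_map (hmp 0).measurable.aemeasurable hg.aestronglyMeasurable]
    rw [this, integral_div, integral_sub hLi (integrable_const _), integral_truncPareto hα hy]
    simp [ha]
  have hW1 : Q[W 0 ^ 2] = 1 := by
    have : ∫ ω, (W 0 ^ 2) ω ∂Q = ∫ t, ((t - a) / √V) ^ 2 ∂truncPareto α y := by
      rw [← (hmp 0).map_eq, integral_map (hmp 0).measurable.aemeasurable
        (hg.pow_const 2).aestronglyMeasurable]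
      rfl
    have hv := variance_eq_integral (μ := truncPareto α y) (X := fun t : ℝ => t) aemeasurable_id
    rw [variance_truncPareto hα hy, integral_truncPareto hα hy] at hv
    simp only [div_pow, Real.sq_sqrt hVpos.le] at this
    rw [this, integral_div, ← hv, div_self hVpos.ne']
  have hind : iIndepFun W Q := iIndepFun_infinitePi (X := fun _ t => (t - a) / √V) fun _ => hg
  have hident (i : ℕ) : IdentDistrib (W i) (W 0) Q Q := by
    have h : IdentDistrib (fun ω : ℕ → ℝ => ω i) (fun ω => ω 0) Q Q :=
      ⟨(hmp i).measurable.aemeasurable, (hmp 0).measurable.aemeasurable, by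
        rw [(hmp i).map_eq, (hmp 0).map_eq]⟩
    exact h.comp hg
  have hclt := tendstoInDistribution_inv_sqrt_mul_sum (Y := id) (P' := gaussianReal 0 1)
    ⟨aemeasurable_id, Measure.map_id⟩ hW0 hW1 hind hident
  have hγ : NullSingletonClass (gaussianReal 0 1) := nullSingletonClass_gaussianReal one_ne_zero
  -- Weak convergence passes to `Iic x` because its boundary `{x}` is Gaussian-null.
  have hlim := ProbabilityMeasure.tendsto_measure_of_null_frontier_of_tendsto' hclt.tendsto
    (E := Iic x) (by simp)
  simp only [ProbabilityMeasure.coe_mk, Measure.map_id] at hlim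
  have hlim' := (ENNReal.tendsto_toReal (measure_ne_top (gaussianReal 0 1) (Iic x))).comp hlim
  refine hlim'.congr fun m => ?_
  have hsum : Measurable fun ω : ℕ → ℝ => ∑ i ∈ Finset.range m, ω i := by fun_prop
  have hset : MeasurableSet {t : ℝ | (t - m * a) / √(m * V) ≤ x} :=
    measurableSet_le (by fun_prop) measurable_const
  have hWm : Measurable fun ω : ℕ → ℝ => (√m)⁻¹ * ∑ k ∈ Finset.range m, W k ω := by
    fun_prop
  simp only [Function.comp_apply]
  rw [← map_sum_infinitePi_truncPareto hα hy, measureReal_def, Measure.map_apply hsum hset,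
    Measure.map_apply hWm measurableSet_Iic]
  congr 2
  ext ω
  have : (√m)⁻¹ * ∑ k ∈ Finset.range m, W k ω
      = (∑ i ∈ Finset.range m, ω i - m * a) / √(m * V) := by
    simp only [W]
    rw [← Finset.sum_div, Finset.sum_sub_distrib, Real.sqrt_mul (Nat.cast_nonneg m)]
    simp only [Finset.sum_const, Finset.card_range, nsmul_eq_mul]
    rw [inv_mul_eq_div, div_div, mul_comm (√V)]
  simp only [mem_preimage, mem_Iic, this, mem_ofPred_eq]

lemma gaussianReal_real_Iic {a V : ℝ} (hV : 0 < V) (x : ℝ) :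
    (gaussianReal a V.toNNReal).real (Iic x) = (gaussianReal 0 1).real (Iic ((x - a) / √V)) := by
  have h : (gaussianReal 0 1).map (fun t => √V * t + a) = gaussianReal a V.toNNReal := by
    have : (fun t : ℝ => √V * t + a) = (fun t => t + a) ∘ fun t => √V * t := rfl
    rw [this, ← Measure.map_map (by fun_prop) (by fun_prop), gaussianReal_map_const_mul,
      gaussianReal_map_add_const]
    congr 1
    · simp
    · ext
      simp [Real.sq_sqrt hV.le, hV.le]
  rw [← h, measureReal_def, Measure.map_apply (by fun_prop) measurableSet_Iic, measureReal_def]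
  congr 2
  ext t
  simp only [mem_preimage, mem_Iic]
  rw [le_div_iff₀ (Real.sqrt_pos.2 hV)]
  constructor <;> intro h <;> linarith

lemma setOf_standardized_le {a V : ℝ} (hV : 0 < V) (x : ℝ) :
    {t : ℝ | (t - a) / √V ≤ (x - a) / √V} = Iic x := by
  ext t
  simp [div_le_div_iff_of_pos_right (Real.sqrt_pos.2 hV)]

/-- The central limit theorem for sums of truncated Pareto variables, uniformly for the distribution
functions. -/
lemma eventually_abs_truncParetoSumLaw_sub_gaussianReal_lt {α : ℝ} (hα : 0 < α) {y : ℝ}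
    (hy : 1 < y) {ε : ℝ} (hε : 0 < ε) : ∀ᶠ m : ℕ in atTop, ∀ x : ℝ,
      |(truncParetoSumLaw α y m).real (Iic x)
        - (gaussianReal (m * trimmedMean α 1 0 y)
            (m * trimmedVar α 1 0 y).toNNReal).real (Iic x)| < ε := by
  have hp (m : ℕ) := isProbabilityMeasure_truncParetoSumLaw hα hy m
  have : NullSingletonClass (gaussianReal 0 1) := nullSingletonClass_gaussianReal one_ne_zero
  -- The approximating Gaussian moves with `m`, so Pólya's theorem is applied after standardising; a
  -- bound uniform in `x` survives the affine change of variable.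
  have hmain := eventually_forall_abs_sub_lt_of_tendsto
    (F := fun m x => (truncParetoSumLaw α y m).real
        {t | (t - m * trimmedMean α 1 0 y) / √(m * trimmedVar α 1 0 y) ≤ x})
    (G := cdf (gaussianReal 0 1))
    (fun m a b hab => measureReal_mono fun t (ht : _ ≤ a) => ht.trans hab)
    (fun _ _ => measureReal_nonneg) (fun _ _ => measureReal_le_one)
    (monotone_cdf _) (continuous_cdf_of_nullSingletonClass _) (tendsto_cdf_atBot _)
    (tendsto_cdf_atTop _) (fun x => by
      rw [cdf_eq_real]
      exact tendsto_truncParetoSumLaw hα hy x) hε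
  filter_upwards [hmain, eventually_gt_atTop 0] with m hm hm0 x
  have hV : 0 < m * trimmedVar α 1 0 y :=
    mul_pos (Nat.cast_pos.2 hm0) (trimmedVar_one_pos hα hy)
  have h := hm ((x - m * trimmedMean α 1 0 y) / √(m * trimmedVar α 1 0 y))
  rwa [cdf_eq_real, ← gaussianReal_real_Iic hV, setOf_standardized_le hV] at h

theorem proposition1 {Ω : Type*} [MeasurableSpace Ω] (P : Measure Ω) [IsProbabilityMeasure P]
    (α : ℝ) (hα : 0 < α) (k : ℕ) (hk : 1 ≤ k)
    (X : ℕ → Ω → ℝ) (hmeas : ∀ i, Measurable (X i)) (hindep : iIndepFun X P)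
    (hlaw : ∀ i, P.map (X i) = paretoMeasure 1 α) :
    -- the regular conditional distribution is the law of a sum of iid truncated Pareto variables
    (∀ n : ℕ, k ≤ n →
      ∀ᵐ y ∂(P.map (orderStat X n (n - k + 1))),
        condDistrib (trimmedSum X n k) (orderStat X n (n - k + 1)) P y
          = truncParetoSumLaw α y (n - k)) ∧
    -- the same at every `y > 1`
    (∀ n : ℕ, k ≤ n → ∀ y : ℝ, 1 < y → ∀ ν : Measure ℝ,
      IsCondLawAt P (trimmedSum X n k) (orderStat X n (n - k + 1)) y ν
        ↔ ν = truncParetoSumLaw α y (n - k)) ∧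
    -- conditional mean and variance in closed form
    (∀ n : ℕ, k ≤ n → ∀ y : ℝ, 1 < y → ∀ ν : Measure ℝ,
      IsCondLawAt P (trimmedSum X n k) (orderStat X n (n - k + 1)) y ν →
        MemLp (fun t : ℝ => t) 2 ν ∧
        ∫ t, t ∂ν = trimmedMean α n k y ∧
        variance (fun t : ℝ => t) ν = trimmedVar α n k y ∧
        (k < n → 0 < trimmedVar α n k y)) ∧
    -- asymptotic normality, for standardized sums and uniformly for the distribution functions
    (∀ y : ℝ, 1 < y → ∀ ν : ℕ → Measure ℝ,
      (∀ n : ℕ, k ≤ n →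
        IsCondLawAt P (trimmedSum X n k) (orderStat X n (n - k + 1)) y (ν n)) →
      (∀ x : ℝ,
        Tendsto
          (fun n : ℕ =>
            (ν n).real {t : ℝ | (t - trimmedMean α n k y) / Real.sqrt (trimmedVar α n k y) ≤ x})
          atTop (𝓝 ((gaussianReal 0 1).real (Iic x)))) ∧
      (∀ ε : ℝ, 0 < ε → ∀ᶠ n : ℕ in atTop, ∀ x : ℝ,
        |(ν n).real (Iic x)
          - (gaussianReal (trimmedMean α n k y) (trimmedVar α n k y).toNNReal).real (Iic x)| < ε)) := by

  -- Here `l` counts the sample points above the conditioning order statistic.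
  obtain ⟨l, rfl⟩ : ∃ l, k = l + 1 := ⟨k - 1, by omega⟩
  have hiff : ∀ n : ℕ, l + 1 ≤ n → ∀ y : ℝ, 1 < y → ∀ ν : Measure ℝ,
      IsCondLawAt P (trimmedSum X n (l + 1)) (orderStat X n (n - (l + 1) + 1)) y ν
        ↔ ν = truncParetoSumLaw α y (n - (l + 1)) := by
    intro n hn y hy ν
    obtain ⟨m, rfl⟩ : ∃ m, n = m + 1 + l := ⟨n - (l + 1), by omega⟩
    have hm : m + 1 + l - (l + 1) = m := by omega
    rw [hm]
    exact isCondLawAt_trimmedSum_iff hα hmeas hindep hlaw m l hy ν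
  have hcast (n : ℕ) (hn : l + 1 ≤ n) : (n : ℝ) - ((l + 1 : ℕ) : ℝ) = ((n - (l + 1) : ℕ) : ℝ) :=
    (Nat.cast_sub hn).symm
  have hmean (n : ℕ) (hn : l + 1 ≤ n) (y : ℝ) : trimmedMean α n (l + 1) y
      = ((n - (l + 1) : ℕ) : ℝ) * trimmedMean α 1 0 y := by
    rw [trimmedMean_eq, hcast n hn]
  have hvar (n : ℕ) (hn : l + 1 ≤ n) (y : ℝ) : trimmedVar α n (l + 1) y
      = ((n - (l + 1) : ℕ) : ℝ) * trimmedVar α 1 0 y := by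
    rw [trimmedVar_eq, hcast n hn]
  refine ⟨?_, hiff, ?_, ?_⟩
  · intro n hn
    obtain ⟨m, rfl⟩ : ∃ m, n = m + 1 + l := ⟨n - (l + 1), by omega⟩
    have hm : m + 1 + l - (l + 1) = m := by omega
    rw [hm]
    exact condDistrib_trimmedSum_ae_eq hα hmeas hindep hlaw m l
  · intro n hn y hy ν hν
    rw [(hiff n hn y hy ν).1 hν, hmean n hn, hvar n hn]
    refine ⟨memLp_truncParetoSumLaw hα hy _, integral_id_truncParetoSumLaw hα hy _,
      variance_id_truncParetoSumLaw hα hy _, fun hkn => ?_⟩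
    exact mul_pos (Nat.cast_pos.2 (Nat.sub_pos_of_lt hkn)) (trimmedVar_one_pos hα hy)
  · intro y hy ν hν
    have hνeq (n : ℕ) (hn : l + 1 ≤ n) : ν n = truncParetoSumLaw α y (n - (l + 1)) :=
      (hiff n hn y hy _).1 (hν n hn)
    refine ⟨fun x => ?_, fun ε hε => ?_⟩
    · refine ((tendsto_truncParetoSumLaw hα hy x).comp
        (tendsto_sub_atTop_nat (l + 1))).congr' ?_
      -- For `n < k` the measure `ν n` is arbitrary, so the identification holds only eventually.
      filter_upwards [eventually_ge_atTop (l + 1)] with n hn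
      rw [hνeq n hn, hmean n hn, hvar n hn]
      rfl
    · filter_upwards [(tendsto_sub_atTop_nat (l + 1)).eventually
        (eventually_abs_truncParetoSumLaw_sub_gaussianReal_lt hα hy hε),
        eventually_ge_atTop (l + 1)] with n hn hln x
      rw [hνeq n hln, hmean n hln, hvar n hln]
      exact hn x
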